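/- Let $d\ge 1$, let $\Omega\subset\mathbb R^d$ be a bounded open set (for instance a bounded Lipschitz domain), $T>0$, $I=(0,T)$, $Q=I\times\Omega$. The space $H_0^1(\Omega)$ carries the scalar product $\int_\Omega\nabla z\cdot\nabla w\,dx$, $H^{-1}(\Omega)$ is its dual with the dual norm, and $\Delta:H_0^1(\Omega)\to H^{-1}(\Omega)$ is the distributional Laplacian. Let $j_1:L^2(I;H_0^1(\Omega))\to\mathbb R$ and $j_2:H_0^1(\Omega)\to\mathbb R$ be continuously Fréchet differentiable and bounded from below; the derivative $j_1'(z)$ is regarded as an element of $L^2(I;H^{-1}(\Omega))=L^2(I;H_0^1(\Omega))'$. For each $\rho>0$ let $|\cdot|_\rho:\mathbb R\to\mathbb R$ be a convex, even function of class $C^{2,1}$ with $|v|_\rho=|v|$ whenever $|v|\ge\rho$ and $|v|_\rho''\le 2/\rho$ for all $v\in\mathbb R$. Then there is a constant $C>0$ such that the following holds for all $\rho>0$ and all $z_\rho\in H^1(I;H_0^1(\Omega))$ (so $C$ is independent of $\rho$ and $z_\rho$). Let $(q_\rho,\xi_\rho)\in H^1(I;H^{-1}(\Omega))\times L^2(I;H_0^1(\Omega))$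 solve the regularized adjoint system $$-\dot q_\rho=\Delta\xi_\rho+j_1'(z_\rho),\qquad -\rho\,\Delta\xi_\rho+|\dot z_\rho|_\rho''\,\xi_\rho=q_\rho\qquad\text{in }H^{-1}(\Omega),\text{ a.e. on }I,$$ $$q_\rho(T)=j_2'(z_\rho(T))\qquad\text{in }H^{-1}(\Omega).$$ Then $$\|q_\rho\|_{L^\infty(I;H^{-1}(\Omega))}+\rho^{1/2}\|\xi_\rho\|_{L^2(I;H_0^1(\Omega))}+\big\||\dot z_\rho|_\rho''\,\xi_\rho^2\big\|_{L^1(Q)}^{1/2}\le C\left(\|j_2'(z_\rho(T))\|_{H^{-1}(\Omega)}+\|j_1'(z_\rho)\|_{L^2(I;H^{-1}(\Omega))}\right).$$ -/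

import Mathlib

open MeasureTheory Set InnerProductSpace
open scoped ENNReal NNReal ContDiff Gradient

noncomputable section

namespace RISControl

/-- `ℝ^d` with the Euclidean norm. -/
abbrev Eu (d : ℕ) := EuclideanSpace ℝ (Fin d)

variable {d : ℕ}

theorem inner_single_one (i : Fin d) (w : Eu d) :
    inner ℝ w (EuclideanSpace.single i (1 : ℝ)) = w i := by
  simp [EuclideanSpace.inner_single_right]

/-! ### The space `H₀¹(Ω)` -/

/-- The space `C_c^∞(Ω)` of smooth real functions with compact support in `Ω`. -/
def testFun (Ω : Set (Eu d)) : Submodule ℝ (Eu d → ℝ) where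
  carrier := {φ | ContDiff ℝ ∞ φ ∧ HasCompactSupport φ ∧ tsupport φ ⊆ Ω}
  add_mem' := by
    rintro φ ψ ⟨h1, h2, h3⟩ ⟨k1, k2, k3⟩
    exact ⟨h1.add k1, h2.add k2, (tsupport_add φ ψ).trans (union_subset h3 k3)⟩
  zero_mem' := ⟨contDiff_const, HasCompactSupport.zero, by simp [tsupport]⟩
  smul_mem' := by
    rintro c φ ⟨h1, h2, h3⟩
    refine ⟨h1.const_smul c, h2.smul_left (f := fun _ => c), ?_⟩
    exact (tsupport_smul_subset_right (fun _ => c) φ).trans h3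

/-- `L²(Ω)`. -/
abbrev L2 (Ω : Set (Eu d)) := Lp ℝ 2 (volume.restrict Ω)

/-- `L²(Ω; ℝ^d)`. -/
abbrev L2Vec (Ω : Set (Eu d)) := Lp (Eu d) 2 (volume.restrict Ω)

theorem testFun_memLp {Ω : Set (Eu d)} (φ : testFun Ω) :
    MemLp (φ : Eu d → ℝ) 2 (volume.restrict Ω) :=
  (φ.2.1.continuous.memLp_of_hasCompactSupport φ.2.2.1).restrict Ω

theorem testFun_gradient_eq {Ω : Set (Eu d)} (φ : testFun Ω) :
    ∇ (φ : Eu d → ℝ) = (toDual ℝ (Eu d)).symm ∘ fderiv ℝ (φ : Eu d → ℝ) := rfl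

theorem testFun_gradient_continuous {Ω : Set (Eu d)} (φ : testFun Ω) :
    Continuous (∇ (φ : Eu d → ℝ)) := by
  rw [testFun_gradient_eq]
  exact (toDual ℝ (Eu d)).symm.continuous.comp (φ.2.1.continuous_fderiv (by simp))

theorem testFun_gradient_hasCompactSupport {Ω : Set (Eu d)} (φ : testFun Ω) :
    HasCompactSupport (∇ (φ : Eu d → ℝ)) := by
  rw [testFun_gradient_eq]
  exact (φ.2.2.1.fderiv (𝕜 := ℝ)).comp_left (map_zero _)

theorem testFun_gradient_memLp {Ω : Set (Eu d)} (φ : testFun Ω) :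
    MemLp (∇ (φ : Eu d → ℝ)) 2 (volume.restrict Ω) :=
  ((testFun_gradient_continuous φ).memLp_of_hasCompactSupport
    (testFun_gradient_hasCompactSupport φ)).restrict Ω

theorem testFun_differentiable {Ω : Set (Eu d)} (φ : testFun Ω) :
    Differentiable ℝ (φ : Eu d → ℝ) := φ.2.1.differentiable (by simp)

/-- The inclusion `C_c^∞(Ω) → L²(Ω)`. -/
def testToL2 (Ω : Set (Eu d)) : testFun Ω →ₗ[ℝ] L2 Ω where
  toFun φ := (testFun_memLp φ).toLp _
  map_add' φ ψ := MemLp.toLp_add (testFun_memLp φ) (testFun_memLp ψ)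
  map_smul' c φ := MemLp.toLp_const_smul c (testFun_memLp φ)

/-- The gradient `C_c^∞(Ω) → L²(Ω; ℝ^d)`. -/
def testGrad (Ω : Set (Eu d)) : testFun Ω →ₗ[ℝ] L2Vec Ω where
  toFun φ := (testFun_gradient_memLp φ).toLp _
  map_add' φ ψ := by
    rw [← MemLp.toLp_add]
    refine MemLp.toLp_congr _ _ (Filter.Eventually.of_forall fun x => ?_)
    simp [gradient, fderiv_add (testFun_differentiable φ x) (testFun_differentiable ψ x)]
  map_smul' c φ := by
    rw [RingHom.id_apply, ← MemLp.toLp_const_smul]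
    refine MemLp.toLp_congr _ _ (Filter.Eventually.of_forall fun x => ?_)
    simp [gradient, fderiv_const_smul (testFun_differentiable φ x) c]

/-- `H₀¹(Ω)`, the completion of `C_c^∞(Ω)` for the norm `‖∇φ‖_{L²}`, realised as the closure of
`{∇φ : φ ∈ C_c^∞(Ω)}` in `L²(Ω; ℝ^d)`.  An element is stored as its gradient, so that the scalar
product is `∫_Ω ∇z · ∇w` and the norm is `‖∇z‖_{L²(Ω)}`; the function itself is `H01.toL2`. -/
def H01Submodule (Ω : Set (Eu d)) : Submodule ℝ (L2Vec Ω) :=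
  (LinearMap.range (testGrad Ω)).topologicalClosure

/-- `H₀¹(Ω)` as a Hilbert space with scalar product `∫_Ω ∇z · ∇w`. -/
abbrev H01 (Ω : Set (Eu d)) := ↥(H01Submodule Ω)

instance (Ω : Set (Eu d)) : CompleteSpace (H01 Ω) :=
  (Submodule.isClosed_topologicalClosure _).completeSpace_coe

/-- The inclusion `C_c^∞(Ω) → H₀¹(Ω)`. -/
def testToH01 (Ω : Set (Eu d)) : testFun Ω →ₗ[ℝ] H01 Ω :=
  (testGrad Ω).codRestrict _ fun φ =>
    Submodule.le_topologicalClosure _ (LinearMap.mem_range_self _ φ)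

/-- The embedding `H₀¹(Ω) → L²(Ω)`: the continuous extension of `∇φ ↦ φ`, `φ ∈ C_c^∞(Ω)`, which
exists by Poincaré's inequality (see `toL2_testToH01`, `toL2_injective`). -/
def H01.toL2 (Ω : Set (Eu d)) : H01 Ω →L[ℝ] L2 Ω :=
  (testToL2 Ω).extendOfNorm (testToH01 Ω)

theorem denseRange_testToH01 (Ω : Set (Eu d)) : DenseRange (testToH01 Ω) := by
  intro x
  rw [closure_subtype, ← range_comp]
  exact x.2

theorem setIntegral_testFun {Ω : Set (Eu d)} (φ : testFun Ω) (f : Eu d → ℝ)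
    (hf : ∀ x, (φ : Eu d → ℝ) x = 0 → f x = 0) :
    ∫ x in Ω, f x = ∫ x, f x :=
  setIntegral_eq_integral_of_forall_compl_eq_zero fun x hx =>
    hf x (image_eq_zero_of_notMem_tsupport fun h => hx (φ.2.2.2 h))

/-- Poincaré's inequality on bounded sets. -/
theorem poincare [NeZero d] {Ω : Set (Eu d)} (hb : Bornology.IsBounded Ω) :
    ∃ C, ∀ φ : testFun Ω, ‖testToL2 Ω φ‖ ≤ C * ‖testToH01 Ω φ‖ := by
  obtain ⟨R, hR0, hR⟩ := hb.exists_pos_norm_le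
  refine ⟨2 * R, fun φ => ?_⟩
  have hd := testFun_differentiable φ
  have hcont := φ.2.1.continuous
  have hcs := φ.2.2.1
  have hgc := testFun_gradient_continuous φ
  have hgs := testFun_gradient_hasCompactSupport φ
  set f : Eu d → ℝ := (φ : Eu d → ℝ) with hf
  set v : Eu d := EuclideanSpace.single 0 1 with hv
  have hn1 : ‖testToL2 Ω φ‖ ^ 2 = ∫ x, f x ^ 2 := by
    rw [← real_inner_self_eq_norm_sq, L2.inner_def, ← setIntegral_testFun φ _ (by
      intro x hx; simp [hf, hx])]
    refine integral_congr_ae ?_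
    filter_upwards [(testFun_memLp φ).coeFn_toLp] with x hx
    have : testToL2 Ω φ x = f x := hx
    simp [this]
  have hn2 : ‖testToH01 Ω φ‖ ^ 2 = ∫ x, ‖∇ f x‖ ^ 2 := by
    have h0 : ‖testToH01 Ω φ‖ = ‖testGrad Ω φ‖ := rfl
    rw [h0, ← real_inner_self_eq_norm_sq, L2.inner_def]
    rw [← setIntegral_eq_integral_of_forall_compl_eq_zero (s := Ω) (f := fun x => ‖∇ f x‖ ^ 2)
      (fun x hx => by
      have : fderiv ℝ f x = 0 := image_eq_zero_of_notMem_tsupport fun h =>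
        hx (φ.2.2.2 (tsupport_fderiv_subset ℝ h))
      simp [gradient, this])]
    refine integral_congr_ae ?_
    filter_upwards [(testFun_gradient_memLp φ).coeFn_toLp] with x hx
    have : testGrad Ω φ x = ∇ f x := hx
    simp [this]
  have hgv : ∀ x, fderiv ℝ f x v = inner ℝ (∇ f x) v := fun x => by
    rw [inner_gradient_left]
  have hfv : Continuous fun x => fderiv ℝ f x v := by
    simp_rw [hgv]; fun_prop
  have hxc : Continuous fun x : Eu d => x 0 := by fun_prop
  have hxd : ∀ x : Eu d, HasFDerivAt (fun x : Eu d => x 0)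
      (EuclideanSpace.proj (0 : Fin d) : Eu d →L[ℝ] ℝ) x := fun x =>
    (EuclideanSpace.proj (0 : Fin d) : Eu d →L[ℝ] ℝ).hasFDerivAt
  have hsq : ∀ x, HasFDerivAt (fun x => f x ^ 2) ((2 * f x) • fderiv ℝ f x) x := fun x => by
    simpa using (hd x).hasFDerivAt.pow 2
  have hsqs : HasCompactSupport fun x => f x ^ 2 := hcs.comp_left (g := fun y => y ^ 2) (by simp)
  have hibp : ∫ x, f x ^ 2 = - ∫ x, (2 * f x * fderiv ℝ f x v) * x 0 := by
    have := integral_bilinear_hasFDerivAt_right_eq_neg_left_of_integrable (μ := volume)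
      (f := fun x => f x ^ 2) (f' := fun x => (2 * f x) • fderiv ℝ f x)
      (g := fun x : Eu d => x 0) (g' := fun _ => (EuclideanSpace.proj (0 : Fin d) : Eu d →L[ℝ] ℝ))
      (v := v) (B := ContinuousLinearMap.mul ℝ ℝ)
      (Continuous.integrable_of_hasCompactSupport (by
          simp only [ContinuousLinearMap.mul_apply', smul_apply, smul_eq_mul]
          fun_prop)
        (hcs.mono (by
          intro x hx; contrapose! hx; simp at hx; simp [hx])))
      (Continuous.integrable_of_hasCompactSupport (by
          simp only [ContinuousLinearMap.mul_apply']
          fun_prop)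
        (hcs.mono (by
          intro x hx; contrapose! hx; simp at hx; simp [hx])))
      (Continuous.integrable_of_hasCompactSupport (by
          simp only [ContinuousLinearMap.mul_apply']
          fun_prop)
        (hcs.mono (by
          intro x hx; contrapose! hx; simp at hx; simp [hx])))
      (fun x _ => hsq x) (fun x _ => hxd x)
    simpa [hv] using this
  have hi1 : Integrable fun x => f x ^ 2 :=
    Continuous.integrable_of_hasCompactSupport (by fun_prop) hsqs
  have hi2 : Integrable fun x => ‖∇ f x‖ ^ 2 :=
    Continuous.integrable_of_hasCompactSupport (by fun_prop)
      (hgs.comp_left (g := fun y => ‖y‖ ^ 2) (by simp))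
  have hle : - ∫ x, (2 * f x * fderiv ℝ f x v) * x 0
      ≤ ∫ x, ((1 / 2) * f x ^ 2 + 2 * R ^ 2 * ‖∇ f x‖ ^ 2) := by
    rw [← integral_neg]
    refine integral_mono (Integrable.neg (Continuous.integrable_of_hasCompactSupport (by fun_prop)
        (hcs.mono (by intro x hx; contrapose! hx; simp at hx; simp [hx]))))
      ((hi1.const_mul _).add (hi2.const_mul _)) fun x => ?_
    have hv1 : |fderiv ℝ f x v| ≤ ‖∇ f x‖ := by
      rw [hgv]
      simpa [hv] using abs_real_inner_le_norm (∇ f x) v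
    have h0R : |f x| * |x 0| ≤ |f x| * R := by
      by_cases hx : f x = 0
      · simp [hx]
      · refine mul_le_mul_of_nonneg_left ?_ (abs_nonneg _)
        have hxΩ : x ∈ Ω := by
          by_contra h
          exact hx (image_eq_zero_of_notMem_tsupport fun h' => h (φ.2.2.2 h'))
        exact (PiLp.norm_apply_le x 0).trans (hR x hxΩ)
    have hprod : (|f x| * |x 0|) * |fderiv ℝ f x v| ≤ (|f x| * R) * ‖∇ f x‖ :=
      mul_le_mul h0R hv1 (abs_nonneg _) (by positivity)
    have habs : -(2 * f x * fderiv ℝ f x v * x 0) ≤ 2 * ((|f x| * |x 0|) * |fderiv ℝ f x v|) := by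
      rw [← abs_mul, ← abs_mul]
      have := neg_abs_le (f x * x 0 * fderiv ℝ f x v)
      linarith
    have hsqx : |f x| ^ 2 = f x ^ 2 := sq_abs _
    have := sq_nonneg (|f x| - 2 * R * ‖∇ f x‖)
    change -(2 * f x * fderiv ℝ f x v * x 0) ≤ 1 / 2 * f x ^ 2 + 2 * R ^ 2 * ‖∇ f x‖ ^ 2
    nlinarith
  rw [integral_add (hi1.const_mul _) (hi2.const_mul _), integral_const_mul, integral_const_mul,
    ← hibp, ← hn1, ← hn2] at hle
  refine abs_le_of_sq_le_sq' ?_ (by positivity) |>.2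
  nlinarith

theorem toL2_testToH01 [NeZero d] {Ω : Set (Eu d)} (hb : Bornology.IsBounded Ω) (φ : testFun Ω) :
    H01.toL2 Ω (testToH01 Ω φ) = testToL2 Ω φ :=
  LinearMap.extendOfNorm_eq (denseRange_testToH01 Ω) (poincare hb) φ

/-- `u ∈ L²(Ω; ℝ^d)` is the weak gradient of `toL2 u`. -/
theorem weak_gradient [NeZero d] {Ω : Set (Eu d)} (hb : Bornology.IsBounded Ω) (u : H01 Ω)
    (ψ : testFun Ω) (i : Fin d) :
    ∫ x in Ω, H01.toL2 Ω u x * (∇ (ψ : Eu d → ℝ) x) i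
      = - ∫ x in Ω, ((u : L2Vec Ω) x) i * (ψ : Eu d → ℝ) x := by
  set e : Eu d := EuclideanSpace.single i 1 with he
  have hg : MemLp (fun x => (∇ (ψ : Eu d → ℝ) x) i) 2 (volume.restrict Ω) := by
    have := (testFun_gradient_memLp ψ).inner_const (𝕜 := ℝ) e
    simpa only [he, inner_single_one] using this
  have hψ : MemLp (fun x => (ψ : Eu d → ℝ) x • e) 2 (volume.restrict Ω) := by
    exact (ContinuousLinearMap.toSpanSingleton ℝ e).comp_memLp' (testFun_memLp ψ)
  have hL : ∀ u : H01 Ω, ∫ x in Ω, H01.toL2 Ω u x * (∇ (ψ : Eu d → ℝ) x) i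
      = inner ℝ (H01.toL2 Ω u) (hg.toLp _) := fun u => by
    rw [L2.inner_def]
    refine integral_congr_ae ?_
    filter_upwards [hg.coeFn_toLp] with x hx
    rw [hx]; simp [mul_comm]
  have hRr : ∀ u : H01 Ω, ∫ x in Ω, ((u : L2Vec Ω) x) i * (ψ : Eu d → ℝ) x
      = inner ℝ (u : L2Vec Ω) (hψ.toLp _) := fun u => by
    rw [L2.inner_def]
    refine integral_congr_ae ?_
    filter_upwards [hψ.coeFn_toLp] with x hx
    rw [hx, inner_smul_right, he, inner_single_one, mul_comm]
  refine (denseRange_testToH01 Ω).induction_on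
    (p := fun u => ∫ x in Ω, H01.toL2 Ω u x * (∇ (ψ : Eu d → ℝ) x) i
      = - ∫ x in Ω, ((u : L2Vec Ω) x) i * (ψ : Eu d → ℝ) x) u ?_ ?_
  · simp_rw [hL, hRr]
    exact isClosed_eq (by fun_prop) (by fun_prop)
  · intro φ
    have h1 : ∫ x in Ω, H01.toL2 Ω (testToH01 Ω φ) x * (∇ (ψ : Eu d → ℝ) x) i
        = ∫ x, (φ : Eu d → ℝ) x * fderiv ℝ (ψ : Eu d → ℝ) x e := by
      rw [toL2_testToH01 hb, ← setIntegral_testFun φ _ (by intro x hx; simp [hx])]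
      refine integral_congr_ae ?_
      filter_upwards [(testFun_memLp φ).coeFn_toLp] with x hx
      have : testToL2 Ω φ x = (φ : Eu d → ℝ) x := hx
      rw [this, ← inner_gradient_left, he, inner_single_one]
    have h2 : ∫ x in Ω, ((testToH01 Ω φ : L2Vec Ω) x) i * (ψ : Eu d → ℝ) x
        = ∫ x, fderiv ℝ (φ : Eu d → ℝ) x e * (ψ : Eu d → ℝ) x := by
      rw [← setIntegral_testFun ψ _ (by intro x hx; simp [hx])]
      refine integral_congr_ae ?_
      filter_upwards [(testFun_gradient_memLp φ).coeFn_toLp] with x hx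
      have : (testToH01 Ω φ : L2Vec Ω) x = ∇ (φ : Eu d → ℝ) x := hx
      rw [this, ← inner_gradient_left, he, inner_single_one]
    have hfe : ∀ χ : testFun Ω, Continuous fun x => fderiv ℝ (χ : Eu d → ℝ) x e := fun χ => by
      have := testFun_gradient_continuous χ
      simp_rw [← inner_gradient_left]; fun_prop
    have hφc := φ.2.1.continuous
    have hψc := ψ.2.1.continuous
    have hφe := hfe φ
    have hψe := hfe ψ
    rw [h1, h2]
    refine integral_mul_fderiv_eq_neg_fderiv_mul_of_integrable ?_ ?_ ?_
      (fun x _ => testFun_differentiable φ x) (fun x _ => testFun_differentiable ψ x)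
    · exact Continuous.integrable_of_hasCompactSupport (by fun_prop) ψ.2.2.1.mul_left
    · exact Continuous.integrable_of_hasCompactSupport (by fun_prop) φ.2.2.1.mul_right
    · exact Continuous.integrable_of_hasCompactSupport (by fun_prop) φ.2.2.1.mul_right

theorem toL2_injective [NeZero d] {Ω : Set (Eu d)} (ho : IsOpen Ω) (hb : Bornology.IsBounded Ω) :
    Function.Injective (H01.toL2 Ω) := by
  rw [injective_iff_map_eq_zero]
  intro u hu
  have hloc : ∀ i : Fin d, ∀ᵐ x, x ∈ Ω → ((u : L2Vec Ω) x) i = 0 := by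
    intro i
    have hm : MemLp (fun x => ((u : L2Vec Ω) x) i) 2 (volume.restrict Ω) := by
      have := (Lp.memLp (u : L2Vec Ω)).inner_const (𝕜 := ℝ) (EuclideanSpace.single i (1 : ℝ))
      simpa only [inner_single_one] using this
    refine ho.ae_eq_zero_of_integral_contDiff_smul_eq_zero ?_ ?_
    · have : IsFiniteMeasure (volume.restrict Ω) := ⟨by simpa using hb.measure_lt_top⟩
      have hI : IntegrableOn (fun x => ((u : L2Vec Ω) x) i) Ω := hm.integrable (by norm_num)
      exact hI.locallyIntegrableOn
    · intro g hg hgc hgs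
      have h := weak_gradient hb u ⟨g, hg, hgc, hgs⟩ i
      have hz : ∫ x in Ω, H01.toL2 Ω u x * (∇ g x) i = 0 := by
        rw [hu, ← integral_zero (Eu d) ℝ (μ := volume.restrict Ω)]
        refine integral_congr_ae ?_
        filter_upwards [Lp.coeFn_zero ℝ 2 (volume.restrict Ω)] with x hx
        rw [hx]; simp
      have h' : ∫ x in Ω, ((u : L2Vec Ω) x) i * g x = 0 := by
        have : (0 : ℝ) = - ∫ x in Ω, ((u : L2Vec Ω) x) i * g x := hz ▸ h
        linarith
      rw [← h', ← setIntegral_testFun ⟨g, hg, hgc, hgs⟩ (fun x => g x • ((u : L2Vec Ω) x) i)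
        (by intro x hx; have : g x = 0 := hx; simp [this])]
      simp [mul_comm]
  refine Subtype.ext (Lp.ext ?_)
  have hall : ∀ᵐ x ∂(volume.restrict Ω), ∀ i, ((u : L2Vec Ω) x) i = 0 :=
    ae_all_iff.2 fun i => (ae_restrict_iff' ho.measurableSet).2 (hloc i)
  filter_upwards [hall, Lp.coeFn_zero (Eu d) 2 (volume.restrict Ω)] with x hx h0
  have : ((0 : H01 Ω) : L2Vec Ω) x = 0 := h0
  rw [this]
  ext i
  simp [hx i]

/-- `H⁻¹(Ω)`, the dual space of `H₀¹(Ω)` with the dual norm. -/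
abbrev Hm1 (Ω : Set (Eu d)) := H01 Ω →L[ℝ] ℝ

/-- The distributional Laplacian `Δ : H₀¹(Ω) → H⁻¹(Ω)`, `⟨Δ z, w⟩ = - ∫_Ω ∇z · ∇w`. -/
def lap (Ω : Set (Eu d)) (z : H01 Ω) : Hm1 Ω := -(toDual ℝ (H01 Ω) z)

theorem lap_apply (Ω : Set (Eu d)) (z w : H01 Ω) :
    lap Ω z w = - ∫ x in Ω, inner ℝ ((z : L2Vec Ω) x) ((w : L2Vec Ω) x) := by
  have : inner ℝ z w = inner ℝ (z : L2Vec Ω) (w : L2Vec Ω) := rfl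
  simp [lap, this, L2.inner_def]

/-! ### Bochner spaces on `I = (0, T)` -/

/-- Lebesgue measure on `I = (0, T)`. -/
abbrev volI (T : ℝ) : Measure ℝ := volume.restrict (Ioo 0 T)

section Bochner

variable {X : Type*} [NormedAddCommGroup X] [NormedSpace ℝ X]

/-- `u ∈ H¹(I; X)` with weak derivative `u'`: here `u` is the continuous representative on `[0, T]`,
so that `u 0` and `u T` are the traces at the end points. -/
structure IsH1 (T : ℝ) (u u' : ℝ → X) : Prop where
  memLp_deriv : MemLp u' 2 (volI T)
  eq_integral : ∀ t ∈ Icc 0 T, u t = u 0 + ∫ s in 0..t, u' s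

theorem IsH1.memLp [CompleteSpace X] {T : ℝ} {u u' : ℝ → X} (h : IsH1 T u u') :
    MemLp u 2 (volI T) := by
  have hint : IntegrableOn u' (Icc 0 T) := by
    rw [integrableOn_Icc_iff_integrableOn_Ioo]
    exact h.memLp_deriv.integrable (by norm_num)
  have hcont : ContinuousOn u (Icc 0 T) := by
    have h1 : ContinuousOn (fun t => u 0 + ∫ s in Ioc 0 t, u' s) (Icc 0 T) :=
      continuousOn_const.add (intervalIntegral.continuousOn_primitive hint)
    refine h1.congr fun t ht => ?_
    rw [h.eq_integral t ht, intervalIntegral.integral_of_le ht.1]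
  obtain ⟨B, hB⟩ := isCompact_Icc.exists_bound_of_continuousOn hcont
  refine MemLp.of_bound ((hcont.mono Ioo_subset_Icc_self).aestronglyMeasurable measurableSet_Ioo)
    B ?_
  filter_upwards [ae_restrict_mem measurableSet_Ioo] with t ht
  exact hB t (Ioo_subset_Icc_self ht)

end Bochner

/-- The element of `L²(I; H')` that represents a bounded linear functional on `L²(I; H)`
(identification `L²(I; H)' = L²(I; H')`, by the Riesz isomorphisms of `L²(I; H)` and `H`). -/
def l2Density {H : Type*} [NormedAddCommGroup H] [InnerProductSpace ℝ H] [CompleteSpace H] {T : ℝ}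
    (F : Lp H 2 (volI T) →L[ℝ] ℝ) (t : ℝ) : H →L[ℝ] ℝ :=
  toDual ℝ H ((toDual ℝ (Lp H 2 (volI T))).symm F t)

theorem l2Density_spec {H : Type*} [NormedAddCommGroup H] [InnerProductSpace ℝ H] [CompleteSpace H]
    {T : ℝ} (F : Lp H 2 (volI T) →L[ℝ] ℝ) :
    MemLp (l2Density F) 2 (volI T) ∧ ∀ v : Lp H 2 (volI T), F v = ∫ t in Ioo 0 T, l2Density F t (v t) := by
  refine ⟨((toDual ℝ H).toContinuousLinearEquiv.toContinuousLinearMap.comp_memLp' (Lp.memLp _)), ?_⟩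
  intro v
  conv_lhs => rw [← (toDual ℝ (Lp H 2 (volI T))).apply_symm_apply F]
  rw [toDual_apply_apply, L2.inner_def]
  simp [l2Density]

/-! ### The regularized problem -/

/-- `f` is an admissible regularization `|·|_ρ` of the modulus with parameter `ρ`. -/
structure IsRegAbs (ρ : ℝ) (f : ℝ → ℝ) : Prop where
  contDiff : ContDiff ℝ 2 f
  lipschitz : ∃ K : ℝ≥0, LipschitzWith K (deriv (deriv f))
  convex : ConvexOn ℝ univ f
  even : ∀ v, f v = f (-v)
  eq_abs : ∀ v, ρ ≤ |v| → f v = |v|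
  deriv2_le : ∀ v, deriv (deriv f) v ≤ 2 / ρ

/-- `(q, ξ)` solves the regularized adjoint system
`-q̇ = Δξ + j₁'(z)`, `q(T) = j₂'(z(T))`, `-ρΔξ + |ż|_ρ'' ξ = q`
in `H⁻¹(Ω)`, a.e. on `I`, with `q ∈ H¹(I; H⁻¹(Ω))` and `ξ ∈ L²(I; H₀¹(Ω))`.
Here `f = |·|_ρ`, `dz = ż`, `dj₁ = j₁'(z)` and `dj₂ = j₂'(z(T))`. -/
structure IsAdjoint (Ω : Set (Eu d)) (T ρ : ℝ) (f : ℝ → ℝ) (dz : ℝ → H01 Ω) (dj₁ : ℝ → Hm1 Ω)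
    (dj₂ : Hm1 Ω) (q : ℝ → Hm1 Ω) (ξ : ℝ → H01 Ω) : Prop where
  memLp_xi : MemLp ξ 2 (volI T)
  eq_q : ∃ q' : ℝ → Hm1 Ω, IsH1 T q q' ∧ ∀ᵐ t ∂(volI T), -(q' t) = lap Ω (ξ t) + dj₁ t
  final : q T = dj₂
  eq_xi : ∀ᵐ t ∂(volI T), ∀ v : H01 Ω,
    -ρ * lap Ω (ξ t) v + (∫ x in Ω, deriv (deriv f) (H01.toL2 Ω (dz t) x)
      * H01.toL2 Ω (ξ t) x * H01.toL2 Ω v x) = q t v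

/-- `‖ |w|_ρ'' ξ² ‖_{L¹(Q)} = ∫_I ∫_Ω | |w|_ρ'' ξ² | dx dt` on `Q = I × Ω`, with `f = |·|_ρ`. -/
def normL1Q (Ω : Set (Eu d)) (T : ℝ) (f : ℝ → ℝ) (w ξ : ℝ → H01 Ω) : ℝ≥0∞ :=
  ∫⁻ t in Ioo 0 T, ∫⁻ x in Ω,
    ‖deriv (deriv f) (H01.toL2 Ω (w t) x) * (H01.toL2 Ω (ξ t) x) ^ 2‖ₑ

end RISControl

end

open RISControl

/-!
The estimate is the energy identity for `‖q‖²` in `H⁻¹(Ω)`. Let `p` be the Riesz representative of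
`q` in `H₀¹(Ω)`, and `g` that of `j₁'(z)`. The first adjoint equation becomes `p' = ξ - g`, so that
`½ d/dt ‖p‖² = ⟨p, ξ⟩ - ⟨p, g⟩`. Testing the second adjoint equation with `ξ` identifies
`⟨p, ξ⟩ = q(ξ) = ρ ‖ξ‖² + ∫_Ω |ż|_ρ'' ξ²`, which is nonnegative because `|·|_ρ` is convex
(`dissipation_eq`). Integrating from `t` to `T`,
`‖p(t)‖² + 2 ∫_t^T ⟨p, ξ⟩ = ‖q(T)‖² + 2 ∫_t^T ⟨p, g⟩ ≤ ‖q(T)‖² + 2 ‖p‖_∞ ‖g‖_{L¹}`.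
Taking `t` where `‖p‖` is maximal gives `‖p‖_∞ ≤ K := ‖q(T)‖ + 2 ‖g‖_{L¹}`, and then `t = 0` gives
`∫_0^T ⟨p, ξ⟩ ≤ K²` (`norm_le_and_integral_inner_le`). Each of the three terms on the left of the
claim is therefore at most `K`, and `‖g‖_{L¹} ≤ T^{1/2} ‖g‖_{L²}` makes the constant
`3 (1 + 2 T^{1/2})`.

The chain rule for `‖p‖²` with `p` only weakly differentiable
(`norm_sq_sub_norm_sq_eq_integral`) follows from the scalar fundamental theorem of calculus: `‖p‖²`
is absolutely continuous, since its increments are controlled by those of `t ↦ ∫_0^t ‖p'‖`.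
-/

namespace RISControl

/-! ### The chain rule for the squared norm -/

theorem absolutelyContinuousOnInterval_of_dist_le_mul {X Y : Type*} [PseudoMetricSpace X]
    [PseudoMetricSpace Y] {f : ℝ → X} {g : ℝ → Y} {a b C : ℝ}
    (hg : AbsolutelyContinuousOnInterval g a b)
    (h : ∀ x ∈ uIcc a b, ∀ y ∈ uIcc a b, dist (f x) (f y) ≤ C * dist (g x) (g y)) :
    AbsolutelyContinuousOnInterval f a b := by
  have hg' := Filter.Tendsto.const_mul C hg
  rw [mul_zero] at hg'
  refine squeeze_zero' (Filter.Eventually.of_forall fun E => by positivity) ?_ hg'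
  filter_upwards [Filter.mem_inf_of_right (Filter.mem_principal_self _)] with E hE
  rw [Finset.mul_sum]
  refine Finset.sum_le_sum fun i hi => ?_
  exact h _ (hE.1 i hi).1 _ (hE.1 i hi).2

theorem continuousOn_of_eq_add_integral {X : Type*} [NormedAddCommGroup X] [NormedSpace ℝ X]
    {p p' : ℝ → X} {a b : ℝ} (hab : a ≤ b)
    (hp' : IntervalIntegrable p' volume a b)
    (hp : ∀ t ∈ Icc a b, p t = p a + ∫ s in a..t, p' s) : ContinuousOn p (Icc a b) := by
  have := intervalIntegral.continuousOn_primitive_interval (μ := volume) (f := p') (a := a)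
    (b := b) (by
      rw [uIcc_of_le hab, integrableOn_Icc_iff_integrableOn_Ioc]; exact hp'.1)
  rw [uIcc_of_le hab] at this
  exact (continuousOn_const.add this).congr hp

section Hilbert

variable {H : Type*} [NormedAddCommGroup H] [InnerProductSpace ℝ H] [CompleteSpace H]

/-- Chain rule for `‖p‖²`, where `p` is a primitive of an integrable function. -/
theorem norm_sq_sub_norm_sq_eq_integral {p p' : ℝ → H} {a b : ℝ} (hab : a ≤ b)
    (hp' : IntervalIntegrable p' volume a b)
    (hp : ∀ t ∈ Icc a b, p t = p a + ∫ s in a..t, p' s) {t : ℝ} (ht : t ∈ Icc a b) :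
    ‖p b‖ ^ 2 - ‖p t‖ ^ 2 = ∫ s in t..b, 2 * inner ℝ (p s) (p' s) := by
  -- `P` extends `p` from `[a, b]` to `ℝ`, so that derivatives also make sense at the end points.
  set P : ℝ → H := fun t => p a + ∫ s in a..t, p' s with hP
  have hu : uIcc a b = Icc a b := uIcc_of_le hab
  have hint : ∀ x ∈ Icc a b, ∀ y ∈ Icc a b, IntervalIntegrable p' volume x y :=
    fun x hx y hy => hp'.mono_set (by rw [hu]; exact uIcc_subset_Icc hx hy)
  have ha : a ∈ Icc a b := left_mem_Icc.2 hab
  have hsub : ∀ x ∈ Icc a b, ∀ y ∈ Icc a b, P x - P y = ∫ s in y..x, p' s := by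
    intro x hx y hy
    simp only [hP, add_sub_add_left_eq_sub]
    exact intervalIntegral.integral_interval_sub_left (hint _ ha _ hx) (hint _ ha _ hy)
  have hcont : ContinuousOn P (Icc a b) :=
    continuousOn_of_eq_add_integral hab hp' fun t _ => by simp [hP]
  obtain ⟨K, hK⟩ := isCompact_Icc.exists_bound_of_continuousOn hcont
  have hAC : AbsolutelyContinuousOnInterval (fun s => ‖P s‖ ^ 2) a b := by
    refine absolutelyContinuousOnInterval_of_dist_le_mul (C := 2 * K)
      (hp'.norm.absolutelyContinuousOnInterval_intervalIntegral (c := a) left_mem_uIcc)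
      fun x hx y hy => ?_
    rw [hu] at hx hy
    have hK0 : 0 ≤ K := (norm_nonneg _).trans (hK x hx)
    have h1 : dist (‖P x‖ ^ 2) (‖P y‖ ^ 2) ≤ 2 * K * ‖P x - P y‖ := by
      rw [Real.dist_eq, sq_sub_sq, abs_mul, abs_of_nonneg (by positivity)]
      exact mul_le_mul (by linarith [hK x hx, hK y hy]) (abs_norm_sub_norm_le _ _)
        (abs_nonneg _) (by positivity)
    refine h1.trans ?_
    gcongr
    rw [Real.dist_eq, intervalIntegral.integral_interval_sub_left (hint _ ha _ hx).norm
      (hint _ ha _ hy).norm, hsub x hx y hy]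
    exact intervalIntegral.norm_integral_le_abs_integral_norm
  have hb : b ∈ Icc a b := right_mem_Icc.2 hab
  have hPp : ∀ s ∈ Icc a b, p s = P s := hp
  rw [hPp b hb, hPp t ht, ← (hAC.mono (c := t) (d := b)
    (by rw [hu]; exact uIcc_subset_Icc ht hb)).integral_deriv_eq_sub]
  refine intervalIntegral.integral_congr_ae ?_
  filter_upwards [hp'.ae_hasDerivAt_integral] with s hs hst
  rw [uIoc_of_le ht.2] at hst
  have hsI : s ∈ Icc a b := ⟨ht.1.trans hst.1.le, hst.2⟩
  have hd : HasDerivAt P (p' s) s := (hs (hu ▸ hsI) a left_mem_uIcc).const_add _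
  rw [hPp s hsI]
  exact hd.norm_sq.deriv

/-! ### The energy estimate in a Hilbert space -/

/-- Energy estimate for the backward equation `p' = ξ - g` when the pairing `⟨p, ξ⟩` is
dissipative. -/
theorem norm_le_and_integral_inner_le {p ξ g : ℝ → H} {T : ℝ} (hT : 0 ≤ T)
    (hξ : IntervalIntegrable ξ volume 0 T) (hg : IntervalIntegrable g volume 0 T)
    (hp : ∀ t ∈ Icc 0 T, p t = p 0 + ∫ s in 0..t, (ξ s - g s))
    (hD : ∀ᵐ t ∂(volume.restrict (Ioc 0 T)), 0 ≤ inner ℝ (p t) (ξ t)) :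
    (∀ t ∈ Icc 0 T, ‖p t‖ ≤ ‖p T‖ + 2 * ∫ s in 0..T, ‖g s‖) ∧
    IntervalIntegrable (fun t => inner ℝ (p t) (ξ t)) volume 0 T ∧
    ∫ t in 0..T, inner ℝ (p t) (ξ t) ≤ (‖p T‖ + 2 * ∫ s in 0..T, ‖g s‖) ^ 2 := by
  have hu : uIcc 0 T = Icc 0 T := uIcc_of_le hT
  have hcont : ContinuousOn p (Icc 0 T) := continuousOn_of_eq_add_integral hT (hξ.sub hg) hp
  have hinner : ∀ {w : ℝ → H}, IntervalIntegrable w volume 0 T →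
      IntervalIntegrable (fun t => inner ℝ (p t) (w t)) volume 0 T := by
    intro w hw
    obtain ⟨K, hK⟩ := isCompact_Icc.exists_bound_of_continuousOn hcont
    have hw' := (intervalIntegrable_iff_integrableOn_Ioc_of_le hT).1 hw
    rw [intervalIntegrable_iff_integrableOn_Ioc_of_le hT]
    refine (hw'.norm.const_mul K).mono' (((hcont.mono Ioc_subset_Icc_self).aestronglyMeasurable
      measurableSet_Ioc).inner hw'.aestronglyMeasurable) ?_
    filter_upwards [ae_restrict_mem measurableSet_Ioc] with s hs
    refine (norm_inner_le_norm _ _).trans ?_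
    gcongr
    exact hK s (Ioc_subset_Icc_self hs)
  have hIξ := hinner hξ
  have hIg := hinner hg
  set B := ∫ s in 0..T, ‖g s‖ with hB
  obtain ⟨t₀, ht₀, hmax⟩ := isCompact_Icc.exists_isMaxOn (nonempty_Icc.2 hT) hcont.norm
  set M := ‖p t₀‖ with hM
  have hle : ∀ t ∈ Icc 0 T, ‖p t‖ ^ 2 + 2 * ∫ s in t..T, inner ℝ (p s) (ξ s)
      ≤ ‖p T‖ ^ 2 + 2 * M * B := by
    intro t ht
    have hs : uIcc t T ⊆ uIcc 0 T := by
      rw [hu]; exact uIcc_subset_Icc ht (right_mem_Icc.2 hT)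
    have h1 := norm_sq_sub_norm_sq_eq_integral hT (hξ.sub hg) hp ht
    have h2 : ∫ s in t..T, 2 * inner ℝ (p s) ((ξ - g) s)
        = 2 * (∫ s in t..T, inner ℝ (p s) (ξ s)) - 2 * ∫ s in t..T, inner ℝ (p s) (g s) := by
      simp_rw [Pi.sub_apply, inner_sub_right]
      rw [intervalIntegral.integral_const_mul,
        intervalIntegral.integral_sub (hIξ.mono_set hs) (hIg.mono_set hs)]
      ring
    have h3 : ∫ s in t..T, inner ℝ (p s) (g s) ≤ M * B := by
      calc ∫ s in t..T, inner ℝ (p s) (g s) ≤ ∫ s in t..T, M * ‖g s‖ := by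
            refine intervalIntegral.integral_mono_on ht.2 (hIg.mono_set hs)
              ((hg.norm.const_mul M).mono_set hs) fun s hs' => ?_
            refine (real_inner_le_norm _ _).trans ?_
            gcongr
            exact hmax ⟨ht.1.trans hs'.1, hs'.2⟩
        _ = M * ∫ s in t..T, ‖g s‖ := intervalIntegral.integral_const_mul _ _
        _ ≤ M * B := by
            refine mul_le_mul_of_nonneg_left ?_ (norm_nonneg _)
            refine intervalIntegral.integral_mono_interval ht.1 ht.2 le_rfl
              (Filter.Eventually.of_forall fun s => norm_nonneg _) hg.norm
    have h1' : ‖p T‖ ^ 2 - ‖p t‖ ^ 2 = ∫ s in t..T, 2 * inner ℝ (p s) ((ξ - g) s) := h1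
    linarith
  have hB0 : 0 ≤ B := intervalIntegral.integral_nonneg hT fun s _ => norm_nonneg _
  have hM0 : 0 ≤ M := norm_nonneg _
  -- At the maximum point `t₀` the bound reads `M² ≤ ‖p T‖² + 2 M B`.
  have hMle : M ≤ ‖p T‖ + 2 * B := by
    have h1 := hle t₀ ht₀
    have h2 : 0 ≤ ∫ s in t₀..T, inner ℝ (p s) (ξ s) := by
      refine intervalIntegral.integral_nonneg_of_ae_restrict ht₀.2 ?_
      rw [Filter.EventuallyLE, ← restrict_Ioc_eq_restrict_Icc]
      exact ae_restrict_of_ae_restrict_of_subset (Ioc_subset_Ioc_left ht₀.1) hD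
    have h3 : ‖p T‖ ≤ M := hmax (right_mem_Icc.2 hT)
    have h0 : 0 ≤ ‖p T‖ := norm_nonneg _
    by_contra! hlt
    nlinarith
  refine ⟨fun t ht => (hmax ht).trans hMle, hIξ, ?_⟩
  have h1 := hle 0 (left_mem_Icc.2 hT)
  have h0 : 0 ≤ ‖p T‖ := norm_nonneg _
  nlinarith [sq_nonneg ‖p 0‖, mul_le_mul_of_nonneg_right hMle hB0, mul_nonneg h0 hB0]

end Hilbert

theorem riesz_apply {H : Type*} [NormedAddCommGroup H] [InnerProductSpace ℝ H] [CompleteSpace H]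
    (q : H →L[ℝ] ℝ) (v : H) : inner ℝ ((toDual ℝ H).symm q) v = q v := by
  rw [← toDual_apply_apply, LinearIsometryEquiv.apply_symm_apply]

/-- The `L¹`-norm in time is bounded by the `L²`-norm (Cauchy–Schwarz). -/
theorem ofReal_integral_norm_le_eLpNorm_two {X : Type*} [NormedAddCommGroup X] {T : ℝ}
    (hT : 0 < T) {g : ℝ → X} (hg : MemLp g 2 (volI T)) :
    ENNReal.ofReal (∫ s in 0..T, ‖g s‖)
      ≤ ENNReal.ofReal (T ^ (1 / 2 : ℝ)) * eLpNorm g 2 (volI T) := by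
  rw [intervalIntegral.integral_of_le hT.le, integral_Ioc_eq_integral_Ioo,
    ofReal_integral_norm_eq_lintegral_enorm (hg.integrable (by norm_num)),
    ← eLpNorm_one_eq_lintegral_enorm, mul_comm]
  refine (eLpNorm_le_eLpNorm_mul_rpow_measure_univ (p := 1) (q := 2) (by norm_num) hg.1).trans ?_
  rw [Measure.restrict_apply_univ, Real.volume_Ioo, sub_zero,
    ENNReal.ofReal_rpow_of_pos hT]
  norm_num

theorem IsH1.riesz {H : Type*} [NormedAddCommGroup H] [InnerProductSpace ℝ H] [CompleteSpace H]
    {T : ℝ} {q q' : ℝ → H →L[ℝ] ℝ} (h : IsH1 T q q') :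
    IsH1 T (fun t => (toDual ℝ H).symm (q t)) (fun t => (toDual ℝ H).symm (q' t)) := by
  let R : (H →L[ℝ] ℝ) →L[ℝ] H := (toDual ℝ H).symm.toContinuousLinearEquiv.toContinuousLinearMap
  refine ⟨R.comp_memLp' h.memLp_deriv, fun t ht => ?_⟩
  have hq' : IntervalIntegrable q' volume 0 t := by
    rw [intervalIntegrable_iff_integrableOn_Ioo_of_le ht.1]
    exact (h.memLp_deriv.integrable (by norm_num)).mono_measure
      (Measure.restrict_mono (Ioo_subset_Ioo_right ht.2) le_rfl)
  change R (q t) = R (q 0) + ∫ s in 0..t, R (q' s)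
  rw [R.intervalIntegral_comp_comm hq', ← map_add, ← h.eq_integral t ht]

/-- `norm_le_and_integral_inner_le`, carried over to the dual space by the Riesz isometry, with
the `L¹`-norm of `g` replaced by `T^{1/2}` times its `L²`-norm. -/
theorem IsH1.energy_estimate {H : Type*} [NormedAddCommGroup H] [InnerProductSpace ℝ H]
    [CompleteSpace H] {T : ℝ} (hT : 0 < T) {q q' g : ℝ → H →L[ℝ] ℝ} {ξ : ℝ → H}
    (hq : IsH1 T q q') (hξ : MemLp ξ 2 (volI T)) (hg : MemLp g 2 (volI T))
    (hqq : ∀ᵐ t ∂(volI T), q' t = toDual ℝ H (ξ t) - g t)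
    (hD : ∀ᵐ t ∂(volI T), 0 ≤ q t (ξ t)) :
    eLpNorm q ∞ (volI T)
      ≤ ‖q T‖ₑ + 2 * ENNReal.ofReal (T ^ (1 / 2 : ℝ)) * eLpNorm g 2 (volI T) ∧
    ∫⁻ t in Ioo 0 T, ENNReal.ofReal (q t (ξ t))
      ≤ (‖q T‖ₑ + 2 * ENNReal.ofReal (T ^ (1 / 2 : ℝ)) * eLpNorm g 2 (volI T)) ^ 2 := by
  have hII : ∀ {u : ℝ → H}, MemLp u 2 (volI T) → IntervalIntegrable u volume 0 T := fun hu => by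
    rw [intervalIntegrable_iff_integrableOn_Ioo_of_le hT.le]
    exact hu.integrable (by norm_num)
  have hp := hq.riesz
  have hgR : MemLp (fun s => (toDual ℝ H).symm (g s)) 2 (volI T) :=
    (toDual ℝ H).symm.toContinuousLinearEquiv.toContinuousLinearMap.comp_memLp' hg
  have hev : ∀ t ∈ Icc 0 T, (toDual ℝ H).symm (q t)
      = (toDual ℝ H).symm (q 0) + ∫ s in 0..t, (ξ s - (toDual ℝ H).symm (g s)) := by
    intro t ht
    rw [hp.eq_integral t ht, intervalIntegral.integral_of_le ht.1,
      intervalIntegral.integral_of_le ht.1, integral_Ioc_eq_integral_Ioo,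
      integral_Ioc_eq_integral_Ioo]
    congr 1
    refine integral_congr_ae
      (ae_restrict_of_ae_restrict_of_subset (Ioo_subset_Ioo_right ht.2) ?_)
    filter_upwards [hqq] with s hs
    rw [hs, map_sub, LinearIsometryEquiv.symm_apply_apply]
  obtain ⟨h1, h2, h3⟩ := norm_le_and_integral_inner_le hT.le (hII hξ) (hII hgR) hev (by
    rw [restrict_Ioo_eq_restrict_Ioc.symm]
    simpa only [riesz_apply] using hD)
  simp only [LinearIsometryEquiv.norm_map] at h1 h3
  simp only [riesz_apply] at h2 h3
  have hB0 : 0 ≤ ∫ s in 0..T, ‖g s‖ :=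
    intervalIntegral.integral_nonneg hT.le fun s _ => norm_nonneg (g s)
  have hK : ENNReal.ofReal (‖q T‖ + 2 * ∫ s in 0..T, ‖g s‖)
      ≤ ‖q T‖ₑ + 2 * ENNReal.ofReal (T ^ (1 / 2 : ℝ)) * eLpNorm g 2 (volI T) := by
    rw [ENNReal.ofReal_add (norm_nonneg _) (by positivity), ENNReal.ofReal_mul (by norm_num),
      ofReal_norm, ENNReal.ofReal_ofNat, mul_assoc]
    gcongr
    exact ofReal_integral_norm_le_eLpNorm_two (X := H →L[ℝ] ℝ) hT hg
  constructor
  · rw [eLpNorm_exponent_top]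
    refine (eLpNormEssSup_le_of_ae_bound ?_).trans hK
    filter_upwards [ae_restrict_mem measurableSet_Ioo] with t ht
    exact h1 t (Ioo_subset_Icc_self ht)
  · rw [← ofReal_integral_eq_lintegral_ofReal
      ((intervalIntegrable_iff_integrableOn_Ioo_of_le hT.le).1 h2) hD,
      ← integral_Ioc_eq_integral_Ioo, ← intervalIntegral.integral_of_le hT.le]
    refine (ENNReal.ofReal_le_ofReal h3).trans ?_
    rw [ENNReal.ofReal_pow (by positivity)]
    gcongr

/-! ### The regularized adjoint system -/

theorem IsRegAbs.deriv_deriv_nonneg {ρ : ℝ} {f : ℝ → ℝ} (hf : IsRegAbs ρ f) (v : ℝ) :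
    0 ≤ deriv (deriv f) v := by
  have hd : Differentiable ℝ f := hf.contDiff.differentiable (by norm_num)
  have hm : Monotone (deriv f) := fun x y h =>
    hf.convex.monotoneOn_deriv (fun x _ => hd x) (mem_univ x) (mem_univ y) h
  exact hm.deriv_nonneg

theorem IsRegAbs.continuous_deriv_deriv {ρ : ℝ} {f : ℝ → ℝ} (hf : IsRegAbs ρ f) :
    Continuous (deriv (deriv f)) := by
  obtain ⟨K, hK⟩ := hf.lipschitz
  exact hK.continuous

theorem IsRegAbs.integrable_deriv_deriv_mul_sq {d : ℕ} {ρ : ℝ} {f : ℝ → ℝ} (hf : IsRegAbs ρ f)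
    {Ω : Set (Eu d)} (w u : L2 Ω) :
    Integrable (fun x => deriv (deriv f) (w x) * u x ^ 2) (volume.restrict Ω) := by
  refine (Lp.memLp u).integrable_sq.bdd_mul (c := 2 / ρ)
    (hf.continuous_deriv_deriv.comp_aestronglyMeasurable (Lp.aestronglyMeasurable w)) ?_
  refine Filter.Eventually.of_forall fun x => ?_
  rw [Real.norm_of_nonneg (hf.deriv_deriv_nonneg _)]
  exact hf.deriv2_le _

/-- The second adjoint equation at a fixed time, tested with `ξ`: the pairing `q(ξ)` splits into the
two nonnegative quantities that are to be estimated. -/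
theorem dissipation_eq {d : ℕ} {ρ : ℝ} (hρ : 0 < ρ) {f : ℝ → ℝ} (hf : IsRegAbs ρ f)
    {Ω : Set (Eu d)} (w ξ : H01 Ω) (q : Hm1 Ω)
    (h : ∀ v : H01 Ω, -ρ * lap Ω ξ v + (∫ x in Ω, deriv (deriv f) (H01.toL2 Ω w x)
      * H01.toL2 Ω ξ x * H01.toL2 Ω v x) = q v) :
    0 ≤ q ξ ∧ ENNReal.ofReal (ρ * ‖ξ‖ ^ 2)
      + ∫⁻ x in Ω, ‖deriv (deriv f) (H01.toL2 Ω w x) * (H01.toL2 Ω ξ x) ^ 2‖ₑ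
        = ENNReal.ofReal (q ξ) := by
  have hnn : ∀ x, 0 ≤ deriv (deriv f) (H01.toL2 Ω w x) * (H01.toL2 Ω ξ x) ^ 2 := fun x =>
    mul_nonneg (hf.deriv_deriv_nonneg _) (sq_nonneg _)
  have hq : q ξ = ρ * ‖ξ‖ ^ 2
      + ∫ x in Ω, deriv (deriv f) (H01.toL2 Ω w x) * (H01.toL2 Ω ξ x) ^ 2 := by
    rw [← h ξ, lap, neg_apply, toDual_apply_apply, real_inner_self_eq_norm_sq,
      neg_mul_neg]
    simp only [sq, mul_assoc]
  have hI := integral_nonneg_of_ae (μ := volume.restrict Ω) (Filter.Eventually.of_forall hnn)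
  refine ⟨hq ▸ add_nonneg (by positivity) hI, ?_⟩
  rw [hq, ENNReal.ofReal_add (by positivity) hI,
    ofReal_integral_eq_lintegral_ofReal (hf.integrable_deriv_deriv_mul_sq _ _)
      (Filter.Eventually.of_forall hnn)]
  congr 1
  exact lintegral_congr fun x => Real.enorm_of_nonneg (hnn x)

theorem IsAdjoint.energy_estimate {d : ℕ} {Ω : Set (Eu d)} {T ρ : ℝ} (hT : 0 < T) (hρ : 0 < ρ)
    {f : ℝ → ℝ} (hf : IsRegAbs ρ f) {w ξ : ℝ → H01 Ω} {g q : ℝ → Hm1 Ω} {b : Hm1 Ω}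
    (hg : MemLp g 2 (volI T)) (h : IsAdjoint Ω T ρ f w g b q ξ) :
    eLpNorm q ∞ (volI T) ≤ ‖b‖ₑ + 2 * ENNReal.ofReal (T ^ (1 / 2 : ℝ)) * eLpNorm g 2 (volI T) ∧
    ∫⁻ t in Ioo 0 T, ENNReal.ofReal (q t (ξ t))
      ≤ (‖b‖ₑ + 2 * ENNReal.ofReal (T ^ (1 / 2 : ℝ)) * eLpNorm g 2 (volI T)) ^ 2 := by
  obtain ⟨q', hq, hqq⟩ := h.eq_q
  rw [← h.final]
  refine hq.energy_estimate hT h.memLp_xi hg ?_ ?_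
  · filter_upwards [hqq] with t ht
    rw [← neg_neg (q' t), ht, lap, neg_add_rev, neg_neg, neg_add_eq_sub]
  · filter_upwards [h.eq_xi] with t ht
    exact (dissipation_eq hρ hf _ _ _ ht).1

end RISControl

theorem mainTheorem10 {d : ℕ} [NeZero d] (Ω : Set (Eu d)) (hΩ : IsOpen Ω)
    (hΩb : Bornology.IsBounded Ω) (T : ℝ) (hT : 0 < T)
    (j₁ : Lp (H01 Ω) 2 (volI T) → ℝ) (hj₁ : ContDiff ℝ 1 j₁) (hj₁b : BddBelow (range j₁))
    (j₂ : H01 Ω → ℝ) (hj₂ : ContDiff ℝ 1 j₂) (hj₂b : BddBelow (range j₂))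
    (absr : ℝ → ℝ → ℝ) (habs : ∀ ρ, 0 < ρ → IsRegAbs ρ (absr ρ)) :
    ∃ C : ℝ≥0, 0 < C ∧ ∀ ρ : ℝ, 0 < ρ → ∀ (z z' : ℝ → H01 Ω) (hz : IsH1 T z z')
      (q : ℝ → Hm1 Ω) (ξ : ℝ → H01 Ω),
      IsAdjoint Ω T ρ (absr ρ) z' (l2Density (fderiv ℝ j₁ (hz.memLp.toLp z)))
        (fderiv ℝ j₂ (z T)) q ξ →
      eLpNorm q ∞ (volI T) + ENNReal.ofReal (ρ ^ (1 / 2 : ℝ)) * eLpNorm ξ 2 (volI T)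
          + (normL1Q Ω T (absr ρ) z' ξ) ^ (1 / 2 : ℝ)
        ≤ C * (‖fderiv ℝ j₂ (z T)‖ₑ
          + eLpNorm (l2Density (fderiv ℝ j₁ (hz.memLp.toLp z))) 2 (volI T)) := by
  refine ⟨3 * (1 + 2 * (T ^ (1 / 2 : ℝ)).toNNReal), by positivity, ?_⟩
  intro ρ hρ z z' hz q ξ had
  have hg := (l2Density_spec (fderiv ℝ j₁ (hz.memLp.toLp z))).1
  obtain ⟨hq, hdiss⟩ := had.energy_estimate hT hρ (habs ρ hρ) hg
  generalize eLpNorm (l2Density (fderiv ℝ j₁ (hz.memLp.toLp z))) 2 (volI T) = G at hq hdiss ⊢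
  generalize ‖fderiv ℝ j₂ (z T)‖ₑ = b at hq hdiss ⊢
  set K : ℝ≥0∞ := b + 2 * ENNReal.ofReal (T ^ (1 / 2 : ℝ)) * G with hK
  have hsqrt : (K ^ 2) ^ (1 / 2 : ℝ) = K := by
    rw [← ENNReal.rpow_natCast_mul]
    norm_num
  have hsplit : ∀ᵐ t ∂(volI T), ENNReal.ofReal (ρ * ‖ξ t‖ ^ 2)
      + ∫⁻ x in Ω, ‖deriv (deriv (absr ρ)) (H01.toL2 Ω (z' t) x) * (H01.toL2 Ω (ξ t) x) ^ 2‖ₑ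
        = ENNReal.ofReal (q t (ξ t)) := by
    filter_upwards [had.eq_xi] with t ht
    exact (dissipation_eq hρ (habs ρ hρ) _ _ _ ht).2
  have hξ : ENNReal.ofReal (ρ ^ (1 / 2 : ℝ)) * eLpNorm ξ 2 (volI T) ≤ K := by
    rw [← hsqrt, eLpNorm_eq_lintegral_rpow_enorm_toReal (by norm_num) (by norm_num),
      ← ENNReal.ofReal_rpow_of_pos hρ, ENNReal.toReal_ofNat,
      ← ENNReal.mul_rpow_of_nonneg _ _ (by norm_num),
      ← lintegral_const_mul' _ _ ENNReal.ofReal_ne_top]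
    refine ENNReal.rpow_le_rpow (le_trans (lintegral_mono_ae ?_) hdiss) (by norm_num)
    filter_upwards [hsplit] with t ht
    rw [← ht, ENNReal.ofReal_mul hρ.le, ENNReal.ofReal_pow (norm_nonneg _), ofReal_norm,
      ENNReal.rpow_ofNat]
    exact le_self_add
  have hL1 : (normL1Q Ω T (absr ρ) z' ξ) ^ (1 / 2 : ℝ) ≤ K := by
    rw [← hsqrt]
    refine ENNReal.rpow_le_rpow (le_trans (lintegral_mono_ae ?_) hdiss) (by norm_num)
    filter_upwards [hsplit] with t ht
    rw [← ht]
    exact le_add_self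
  refine (add_le_add (add_le_add hq hξ) hL1).trans ?_
  push_cast
  change K + K + K ≤ 3 * (1 + 2 * ENNReal.ofReal (T ^ (1 / 2 : ℝ))) * (b + G)
  -- The terms `G` and `2 T^{1/2} b` are added to complete the product on the right.
  calc K + K + K ≤ K + K + K + 3 * (G + 2 * ENNReal.ofReal (T ^ (1 / 2 : ℝ)) * b) := le_self_add
    _ = _ := by rw [hK]; ring
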